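/- For $n\ge 2$ let $\Sigma_n=\{0,1,\dots,n-1\}$, with letters added and subtracted modulo $n$. Let $\varphi_{e,n}(a)=a(a+1)\cdots(a-2)(a-1)$ and $\varphi_{o,n}(a)=(a-1)(a-2)\cdots(a+1)a$ for $a\in\Sigma_n$ (both words have length $n$), and for a finite word $u=u_0u_1\cdots u_m$ over $\Sigma_n$ let $\varphi_n(u)=\varphi_{e,n}(u_0)\varphi_{o,n}(u_1)\varphi_{e,n}(u_2)\varphi_{o,n}(u_3)\cdots$. For $n\ge 3$ the Arshon word of order $n$ is the infinite word $\mathbf a_n=a_0a_1a_2\cdots=\lim_{k\to\infty}\varphi_n^k(0)$; for $n=2$, the Arshon word $\mathbf a_2$ is the Thue–Morse word $01101001\cdots$, whose $i$-th letter ($i\ge 0$) is the parity of the sum of the binary digits of $i$. A finite word $z$ is an $r$-power, $r\in\mathbb Q$, if $z=x^my$ with $x$ a non-empty word, $m\ge 1$ an integer, $y$ a (possibly empty) prefix of $x$, and $r=|z|/|x|$. The critical exponent $E(\mathbf w)$ of an infinite word $\mathbf w$ is the supremum of the rational numbers $r\ge 1$ such that some subword (block of consecutive letters) of $\mathbf w$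 is an $r$-power. **Theorem.** For every $n\ge 2$, $$E(\mathbf a_n)=\frac{3n-2}{2n-2},$$ and this exponent is attained by a subword beginning at position $1$: some subword $a_1a_2\cdots a_l$ of $\mathbf a_n$ (positions being counted from $0$) is a $\frac{3n-2}{2n-2}$-power. -/

import Mathlib

/-- A finite word `z` is a fractional power of exponent `r` (an `r`-power): `z = x ^ m y` with `x`
non-empty, `m` a positive integer, `y` a (possibly empty) prefix of `x`, and `r = |z| / |x|`. -/
def IsFracPower {α : Type*} (z : List α) (r : ℚ) : Prop :=
  ∃ (x y : List α) (m : ℕ), x ≠ [] ∧ 1 ≤ m ∧ y <+: x ∧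
    z = (List.replicate m x).flatten ++ y ∧ r = (z.length : ℚ) / (x.length : ℚ)

/-- The subword of length `l` of the infinite word `w` that begins at position `i`
(positions are counted from `0`). -/
def subwordAt {α : Type*} (w : ℕ → α) (i l : ℕ) : List α :=
  (List.range l).map fun k => w (i + k)

/-- The critical exponent of an infinite word: the supremum, taken in the extended reals, of the
rational numbers `r ≥ 1` such that some subword of `w` is an `r`-power. -/
noncomputable def criticalExponent {α : Type*} (w : ℕ → α) : EReal :=
  sSup {e : EReal | ∃ r : ℚ, 1 ≤ r ∧ (∃ i l : ℕ, IsFracPower (subwordAt w i l) r) ∧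
    e = ((r : ℝ) : EReal)}

/-- The even Arshon morphism on letters: `a ↦ a (a+1) ⋯ (a-2) (a-1)`, letters taken mod `n`. -/
def arshonEven (n : ℕ) (a : ZMod n) : List (ZMod n) :=
  (List.range n).map fun k => a + (k : ZMod n)

/-- The odd Arshon morphism on letters: `a ↦ (a-1) (a-2) ⋯ (a+1) a`, letters taken mod `n`. -/
def arshonOdd (n : ℕ) (a : ZMod n) : List (ZMod n) :=
  (List.range n).map fun k => a - 1 - (k : ZMod n)

/-- The Arshon operator on finite words: letters at even positions are replaced by their images
under the even morphism, letters at odd positions by their images under the odd morphism. -/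
def arshonMap (n : ℕ) (u : List (ZMod n)) : List (ZMod n) :=
  (u.mapIdx fun i a => if Even i then arshonEven n a else arshonOdd n a).flatten

/-- The limit of the words `φ ^ k (0)`, where `φ` is the Arshon operator of order `n`. For `2 ≤ n`
the word `φ ^ i (0)` has length `n ^ i > i`, so it has a letter at position `i`; that each
`φ ^ k (0)` is a prefix of the limit is `arshonLimit_prefix` below. -/
def arshonLimit (n : ℕ) (i : ℕ) : ZMod n :=
  ((arshonMap n)^[i] [0]).getD i 0

/-- The Thue–Morse word `0110 1001 ⋯`: the parity of the sum of the binary digits of `i`. -/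
def thueMorse (i : ℕ) : ℕ := (Nat.digits 2 i).sum % 2

/-- The Arshon word of order `n`, for `2 ≤ n`: the Thue–Morse word for `n = 2`, and the limit of
the iterates of the Arshon operator on the letter `0` for `3 ≤ n`. -/
def arshonWord (n : ℕ) (i : ℕ) : ZMod n :=
  if n = 2 then (thueMorse i : ZMod n) else arshonLimit n i

theorem arshonMap_append (n : ℕ) (u v : List (ZMod n)) :
    arshonMap n u <+: arshonMap n (u ++ v) := by
  simp [arshonMap, List.mapIdx_append]

theorem arshonMap_length (n : ℕ) (u : List (ZMod n)) :
    (arshonMap n u).length = u.length * n := by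
  unfold arshonMap
  induction u using List.reverseRecOn with
  | nil => simp
  | append_singleton u a ih =>
    rw [List.mapIdx_append, List.flatten_append, List.length_append, ih, List.length_append,
      Nat.add_mul]
    congr 1
    simp only [List.mapIdx_cons, List.mapIdx_nil, List.flatten_cons, List.flatten_nil,
      List.append_nil, List.length_singleton, one_mul]
    split_ifs <;> simp [arshonEven, arshonOdd]

theorem arshonIter_length (n k : ℕ) : ((arshonMap n)^[k] [0]).length = n ^ k := by
  induction k with
  | zero => simp
  | succ k ih => rw [Function.iterate_succ_apply', arshonMap_length, ih, pow_succ]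

theorem arshonIter_prefix_succ {n : ℕ} (hn : 2 ≤ n) (k : ℕ) :
    (arshonMap n)^[k] [0] <+: (arshonMap n)^[k + 1] [0] := by
  induction k with
  | zero =>
    obtain ⟨m, rfl⟩ : ∃ m, n = m + 1 := ⟨n - 1, by omega⟩
    simp [arshonMap, arshonEven, List.range_succ_eq_map]
  | succ k ih =>
    rw [Function.iterate_succ_apply', Function.iterate_succ_apply' _ (k + 1)]
    obtain ⟨v, hv⟩ := ih
    rw [← hv]
    exact arshonMap_append n _ v

theorem arshonIter_prefix {n : ℕ} (hn : 2 ≤ n) {k l : ℕ} (h : k ≤ l) :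
    (arshonMap n)^[k] [0] <+: (arshonMap n)^[l] [0] := by
  induction l, h using Nat.le_induction with
  | base => exact List.prefix_rfl
  | succ l _ ih => exact ih.trans (arshonIter_prefix_succ hn l)

/-- Every iterate of the Arshon operator on `0` is a prefix of the limit word. -/
theorem arshonLimit_prefix {n : ℕ} (hn : 2 ≤ n) (k : ℕ) :
    (arshonMap n)^[k] [0] = subwordAt (arshonLimit n) 0 (n ^ k) := by
  apply List.ext_getElem
  · simp [subwordAt, arshonIter_length]
  · intro i h1 h2
    have hi : i < ((arshonMap n)^[i] [0]).length := by
      rw [arshonIter_length]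
      exact Nat.lt_pow_self (by omega)
    simp only [subwordAt, List.getElem_map, List.getElem_range, zero_add, arshonLimit]
    rw [List.getD_eq_getElem _ _ hi]
    rcases le_total k i with h | h
    · exact (arshonIter_prefix hn h).getElem h1
    · exact ((arshonIter_prefix hn h).getElem hi).symm

/-! A power of exponent `1 + q/p` is a window of `q` positions on which the word agrees with its
shift by `p`, so the upper bound reads `2nq ≤ np + 2q`.

For `n ≥ 3`, consecutive letters differ by a sign `±1`. Inside block `m` (the image of letter `m`)
every sign is `(-1)^m`, and the step out of block `m` repeats the step from letter `m` to letter `m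
+ 1`. This self-similarity (`IsArshonSigns`) is all the bound uses. Take a repetition violating it.
If `n ∣ p`, then `p/n` is even, so blocks are compared with blocks of the same orientation and the
repetition desubstitutes to a shorter violating one (`repetition_le`). If `n ∤ p`, there is a
contradiction (`dvd_of_repetition`). Sign changes occur only beside block ends, so one inside the
window forces `p ≡ ±1` mod `n`. Comparing signs then makes three consecutive signs alternate unless
the window is short, and the few remaining periods fail by summing signs mod `n`. Without a sign
change the window is monotone, and counting run lengths excludes it (`false_of_constant`).

For `n = 2` the bound is overlap-freeness of Thue–Morse. Equality comes from period `2n - 2` and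
overlap `n` at position `1`. -/

/-! ### Letters of the limit word, block by block -/

theorem List.flatMap_singleton_eq_map {α β : Type*} (f : α → β) (l : List α) :
    (l.flatMap fun a => [f a]) = l.map f :=
  List.flatMap_pure_eq_map f l

theorem arshonMap_append_singleton (n : ℕ) (u : List (ZMod n)) (a : ZMod n) :
    arshonMap n (u ++ [a]) =
      arshonMap n u ++ if Even u.length then arshonEven n a else arshonOdd n a := by
  simp [arshonMap, List.mapIdx_append]

theorem arshonMap_getElem? (n : ℕ) (u : List (ZMod n)) {m k : ℕ} (hm : m < u.length)
    (hk : k < n) :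
    (arshonMap n u)[n * m + k]? =
      some (if Even m then u[m] + (k : ZMod n) else u[m] - 1 - (k : ZMod n)) := by
  induction u using List.reverseRecOn with
  | nil => simp at hm
  | append_singleton u a ih =>
    rw [arshonMap_append_singleton]
    rcases lt_or_ge m u.length with h | h
    · have hlt : n * m + k < (arshonMap n u).length := by
        rw [arshonMap_length]
        nlinarith
      rw [List.getElem?_append_left hlt, ih h, List.getElem_append_left h]
    · obtain rfl : m = u.length := by
        simp at hm
        omega
      have hle : (arshonMap n u).length ≤ n * u.length + k := by
        rw [arshonMap_length, mul_comm]
        omega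
      rw [List.getElem?_append_right hle, arshonMap_length, mul_comm u.length n,
        Nat.add_sub_cancel_left]
      split_ifs <;> simp [arshonEven, arshonOdd, hk, List.flatMap_singleton_eq_map]

theorem arshonLimit_mul_add {n : ℕ} (hn : 2 ≤ n) (m k : ℕ) (hk : k < n) :
    arshonLimit n (n * m + k) =
      if Even m then arshonLimit n m + (k : ZMod n) else arshonLimit n m - 1 - (k : ZMod n) := by
  have hm : m < n ^ m := Nat.lt_pow_self (by omega)
  have h := arshonLimit_prefix hn (m + 1)
  rw [Function.iterate_succ_apply', arshonLimit_prefix hn m] at h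
  have hlen : m < (subwordAt (arshonLimit n) 0 (n ^ m)).length := by simpa [subwordAt] using hm
  have h1 := arshonMap_getElem? n _ hlen hk
  have hlt : n * m + k < n ^ (m + 1) := by
    rw [pow_succ]
    nlinarith
  rw [h] at h1
  simpa [subwordAt, hlt] using h1

theorem arshonLimit_zero (n : ℕ) : arshonLimit n 0 = 0 := by
  simp [arshonLimit]

theorem arshonLimit_of_lt {n : ℕ} (hn : 2 ≤ n) {k : ℕ} (hk : k < n) :
    arshonLimit n k = (k : ZMod n) := by
  simpa [arshonLimit_zero] using arshonLimit_mul_add hn 0 k hk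

/-! ### The sequence of signs -/

/-- `s` is the sequence of signs `±1` of the steps of the word `w`, where `w` is invariant under
the Arshon operator of order `n`. -/
structure IsArshonSigns (n : ℕ) (w : ℕ → ZMod n) (s : ℕ → ℤ) : Prop where
  word : ∀ m k, k < n → w (n * m + k) =
    if Even m then w m + (k : ZMod n) else w m - 1 - (k : ZMod n)
  step : ∀ j, w (j + 1) = w j + (s j : ZMod n)
  sign : ∀ j, s j = 1 ∨ s j = -1
  inner : ∀ m k, k + 1 < n → s (n * m + k) = (-1) ^ m
  last : ∀ m k, k + 1 = n → s (n * m + k) = s m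

theorem neg_one_pow_eq_or_int (m : ℕ) : (-1 : ℤ) ^ m = 1 ∨ (-1 : ℤ) ^ m = -1 :=
  neg_one_pow_eq_or ℤ m

theorem ZMod.natCast_eq_neg_one {n k : ℕ} (h : k + 1 = n) : (k : ZMod n) = -1 := by
  have : ((k + 1 : ℕ) : ZMod n) = 0 := by rw [h]; simp
  push_cast at this
  exact eq_neg_of_add_eq_zero_left this

theorem ZMod.intCast_ne_zero_of_lt {n : ℕ} {x : ℤ} (h0 : x ≠ 0) (h : |x| < n) :
    (x : ZMod n) ≠ 0 := by
  intro hx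
  rw [ZMod.intCast_zmod_eq_zero_iff_dvd] at hx
  exact h0 (Int.eq_zero_of_abs_lt_dvd hx h)

theorem arshonLimit_step_inner {n : ℕ} (hn : 2 ≤ n) (m k : ℕ) (hk : k + 1 < n) :
    arshonLimit n (n * m + k + 1) = arshonLimit n (n * m + k) + (((-1) ^ m : ℤ) : ZMod n) := by
  rw [add_assoc, arshonLimit_mul_add hn m (k + 1) hk, arshonLimit_mul_add hn m k (by omega)]
  rcases Nat.even_or_odd m with h | h
  · simp [h, h.neg_one_pow]
    ring
  · simp [Nat.not_even_iff_odd.2 h, h.neg_one_pow]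
    ring

/-- An even block of `a` ends in `a - 1` and the next block starts with `b - 1`; an odd block of `a`
ends in `a` and the next starts with `b`. Both steps are `b - a`. -/
theorem arshonLimit_step_last {n : ℕ} (hn : 2 ≤ n) (m k : ℕ) (hk : k + 1 = n) :
    arshonLimit n (n * m + k + 1) - arshonLimit n (n * m + k) =
      arshonLimit n (m + 1) - arshonLimit n m := by
  have h : n * m + k + 1 = n * (m + 1) + 0 := by rw [mul_add]; omega
  rw [h, arshonLimit_mul_add hn (m + 1) 0 (by omega), arshonLimit_mul_add hn m k (by omega),
    ZMod.natCast_eq_neg_one hk]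
  rcases Nat.even_or_odd m with h | h
  · simp [h, Nat.even_add_one]
    ring
  · simp [Nat.not_even_iff_odd.2 h, Nat.even_add_one]

theorem exists_isArshonSigns {n : ℕ} (hn : 3 ≤ n) : ∃ s, IsArshonSigns n (arshonLimit n) s := by
  have key : ∀ j, arshonLimit n (j + 1) - arshonLimit n j = 1 ∨
      arshonLimit n (j + 1) - arshonLimit n j = -1 := by
    intro j
    induction j using Nat.strong_induction_on with
    | _ j ih =>
      have hr := Nat.mod_lt j (show 0 < n by omega)
      have hd := Nat.div_add_mod j n
      rcases (show j % n + 1 < n ∨ j % n + 1 = n by omega) with h | h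
      · have := arshonLimit_step_inner (by omega : 2 ≤ n) (j / n) _ h
        rw [hd] at this
        rw [this]
        rcases neg_one_pow_eq_or_int (j / n) with h | h <;> simp [h]
      · have := arshonLimit_step_last (by omega : 2 ≤ n) (j / n) _ h
        rw [hd] at this
        rw [this]
        refine ih _ (Nat.div_lt_self ?_ (by omega))
        rcases Nat.eq_zero_or_pos j with rfl | h0
        · simp at h
          omega
        · exact h0
  have hne : (1 : ZMod n) ≠ -1 := by
    intro h
    refine ZMod.intCast_ne_zero_of_lt (n := n) (x := 2) (by norm_num) (by simp; omega) ?_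
    push_cast
    linear_combination h
  refine ⟨fun j => if arshonLimit n (j + 1) - arshonLimit n j = 1 then 1 else -1,
    arshonLimit_mul_add (by omega), ?_, ?_, ?_, ?_⟩
  · intro j
    rcases key j with h | h
    · simp [h, ← sub_eq_iff_eq_add']
    · simp [h, hne.symm, ← sub_eq_add_neg]
      linear_combination h
  · intro j
    split_ifs <;> simp
  · intro m k hk
    rw [arshonLimit_step_inner (by omega) m k hk]
    rcases neg_one_pow_eq_or_int m with h | h <;> simp [h, hne.symm]
  · intro m k hk
    rw [arshonLimit_step_last (by omega) m k hk]

/-! ### Sign changes and monotone windows -/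

namespace IsArshonSigns

variable {n : ℕ} {w : ℕ → ZMod n} {s : ℕ → ℤ}

theorem eq_neg_of_ne (h : IsArshonSigns n w s) {j x} (hx : x = 1 ∨ x = -1) (hj : s j ≠ x) :
    s j = -x := by
  have := h.sign j
  omega

/-- Inner signs of adjacent blocks are opposite, so the boundary sign between them agrees with
exactly one side. The change comes just before or just after it, according to the sign `s m` of the
parent step. -/
theorem of_ne (h : IsArshonSigns n w s) (hn : 3 ≤ n) {c : ℕ} (hc : s c ≠ s (c + 1)) :
    ∃ m, c + 2 = n * m + n ∧ s m = -(-1) ^ m ∨ c + 1 = n * m + n ∧ s m = (-1) ^ m := by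
  obtain ⟨m, k, hk, rfl⟩ : ∃ m k, k < n ∧ c = n * m + k :=
    ⟨c / n, c % n, Nat.mod_lt _ (by omega), (Nat.div_add_mod c n).symm⟩
  refine ⟨m, ?_⟩
  rcases (show k + 2 < n ∨ k + 2 = n ∨ k + 1 = n by omega) with h1 | h1 | h1
  · refine absurd ?_ hc
    rw [add_assoc, h.inner m k (by omega), h.inner m (k + 1) (by omega)]
  · left
    refine ⟨by omega, ?_⟩
    rw [h.inner m k (by omega), add_assoc, h.last m (k + 1) (by omega)] at hc
    exact h.eq_neg_of_ne (neg_one_pow_eq_or_int m) hc.symm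
  · right
    refine ⟨by omega, ?_⟩
    rw [h.last m k h1, show n * m + k + 1 = n * (m + 1) + 0 by rw [mul_add]; omega,
      h.inner (m + 1) 0 (by omega), pow_succ] at hc
    have := h.sign m
    have := neg_one_pow_eq_or_int m
    omega

theorem run (h : IsArshonSigns n w s) (hn : 3 ≤ n) {c : ℕ} (hc : s c ≠ s (c + 1)) {j : ℕ}
    (hj : j + 1 < n) : s (c + 1 + j) = s (c + 1) := by
  obtain ⟨m, ⟨h1, h2⟩ | ⟨h1, h2⟩⟩ := h.of_ne hn hc
  · have e1 : s (c + 1) = s m := by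
      rw [show c + 1 = n * m + (n - 1) by omega, h.last m _ (by omega)]
    cases j with
    | zero => rfl
    | succ j =>
      rw [show c + 1 + (j + 1) = n * (m + 1) + j by rw [mul_add]; omega,
        h.inner _ _ (by omega), e1, h2, pow_succ]
      ring
  · rw [show c + 1 + j = n * (m + 1) + j by rw [mul_add]; omega,
      show c + 1 = n * (m + 1) + 0 by rw [mul_add]; omega, h.inner _ _ (by omega),
      h.inner _ _ (by omega)]

/-- Runs of equal signs have length at least two. -/
theorem not_alternating (h : IsArshonSigns n w s) (hn : 3 ≤ n) {c : ℕ} (h1 : s (c + 1) = -s c)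
    (h2 : s (c + 2) = s c) : False := by
  have hc := h.sign c
  have := h.run hn (c := c) (by omega) (j := 1) (by omega)
  rw [show c + 1 + 1 = c + 2 by ring] at this
  omega

/-- Any other residue puts inner signs of two adjacent blocks in the window, and these are opposite.
-/
theorem mod_of_constant (h : IsArshonSigns n w s) (hn : 3 ≤ n) {i : ℕ} {x : ℤ}
    (hx : ∀ j ≤ n, s (i + j) = x) : i % n = n - 1 := by
  have hr := Nat.mod_lt i (show 0 < n by omega)
  have hd := Nat.div_add_mod i n
  by_contra hne
  have h1 := hx (n - 2 - i % n) (by omega)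
  have h2 := hx (n - i % n) (by omega)
  rw [show i + (n - 2 - i % n) = n * (i / n) + (n - 2) by omega, h.inner _ _ (by omega)] at h1
  rw [show i + (n - i % n) = n * (i / n + 1) + 0 by rw [mul_add]; omega,
    h.inner _ _ (by omega), pow_succ] at h2
  have := neg_one_pow_eq_or_int (i / n)
  omega

theorem word_add_of_constant (h : IsArshonSigns n w s) {i t : ℕ} {x : ℤ}
    (hx : ∀ j < t, s (i + j) = x) : w (i + t) = w i + (t : ZMod n) * (x : ZMod n) := by
  induction t with
  | zero => simp
  | succ t ih =>
    rw [← add_assoc, h.step, ih fun j hj => hx j (by omega), hx t (by omega)]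
    push_cast
    ring

/-- A long repetition whose period is not a multiple of `n` is not monotone. -/
theorem false_of_constant (h : IsArshonSigns n w s) (hn : 3 ≤ n) {i p L : ℕ} {x : ℤ}
    (hL : 1 ≤ L) (hp : ¬ n ∣ p) (hw : w i = w (i + p)) (h1 : ∀ j < L, s (i + j) = x)
    (h2 : ∀ j < L, s (i + p + j) = x) (hbad : n * p + 2 * (L + 1) < 2 * n * (L + 1)) : False := by
  have hx : x = 1 ∨ x = -1 := h1 0 (by omega) ▸ h.sign _
  have hx0 : (x : ZMod n) ≠ 0 := ZMod.intCast_ne_zero_of_lt (by omega) (by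
    rcases hx with rfl | rfl <;> simp <;> omega)
  have hLn : L ≤ n + 1 := by
    by_contra hlt
    have e1 := h.mod_of_constant hn (i := i) fun j hj => h1 j (by omega)
    have e2 := h.mod_of_constant hn (i := i + 1) (x := x) fun j hj => by
      rw [add_assoc]
      exact h1 (1 + j) (by omega)
    have e3 : i % n = (i + 1) % n := e1.trans e2.symm
    have : n ∣ 1 := by simpa using (Nat.modEq_iff_dvd' (by omega : i ≤ i + 1)).1 e3
    have := Nat.le_of_dvd one_pos this
    omega
  -- With no change before `i + p`, the letter drifts by `±p`, and `w i = w (i + p)` gives `n ∣ p`.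
  by_cases hex : ∃ t, t < p ∧ s (i + t) ≠ x
  swap
  · push Not at hex
    have e := h.word_add_of_constant hex
    rw [← hw, left_eq_add] at e
    apply hp
    rw [← ZMod.natCast_eq_zero_iff]
    rcases hx with rfl | rfl <;> simpa using e
  classical
  set t := Nat.find hex with ht
  obtain ⟨htp, hts⟩ := Nat.find_spec hex
  have hmin : ∀ j < t, s (i + j) = x := fun j hj => by
    by_contra hne
    exact Nat.find_min hex hj ⟨by omega, hne⟩
  have htL : L ≤ t := by
    by_contra hlt
    exact hts (h1 _ (by omega))
  have hst : s (i + t) = -x := h.eq_neg_of_ne hx hts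
  have hrun : ∀ j, j < n - 1 → s (i + t + j) = -x := fun j hj => by
    have := h.run hn (c := i + t - 1) (by
      rw [show i + t - 1 + 1 = i + t by omega, show i + t - 1 = i + (t - 1) by omega,
        hmin _ (by omega)]
      exact hts.symm) (j := j) (by omega)
    rw [show i + t - 1 + 1 = i + t by omega] at this
    rw [this, hst]
  -- The opposite run starting at `i + t` has at least `n - 1` signs and must end before the second
  -- copy starts.
  have hpt : t + (n - 1) ≤ p := by
    by_contra hlt
    have e1 := hrun (p - t) (by omega)
    rw [show i + t + (p - t) = i + p + 0 by omega, h2 0 (by omega)] at e1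
    omega
  obtain ⟨d, rfl⟩ : ∃ d, n = d + 3 := ⟨n - 3, by omega⟩
  have hLn' : d + 3 ≤ L := by
    by_contra hlt
    obtain ⟨e, he⟩ : ∃ e, d + 2 = L + e := ⟨d + 2 - L, by omega⟩
    have : L + d + 2 ≤ p := by omega
    nlinarith
  -- If `L = n`, then `t = n` and `p = 2n - 1`, so the net drift is `n x - (n - 1) x = x`, nonzero
  -- mod `n`. If `L = n + 1`, both copies start at residue `n - 1`, so `n ∣ p`.
  rcases (show L = d + 3 ∨ L = d + 4 by omega) with rfl | rfl
  · have : p < 2 * (d + 3) := by nlinarith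
    have e1 := h.word_add_of_constant hrun
    rw [h.word_add_of_constant hmin, show i + t + (d + 3 - 1) = i + p by omega, ← hw,
      show t = d + 3 by omega] at e1
    have e2 : ((d + 3 - 1 : ℕ) : ZMod (d + 3)) = -1 := ZMod.natCast_eq_neg_one (by omega)
    rw [e2, ZMod.natCast_self] at e1
    apply hx0
    push_cast at e1
    linear_combination -e1
  · have : p < 2 * (d + 3) + 2 := by nlinarith
    have hne : p ≠ 2 * (d + 3) := fun e => hp ⟨2, by omega⟩
    have e1 := h.mod_of_constant hn (i := i) fun j hj => h1 j (by omega)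
    have e2 := h.mod_of_constant hn (i := i + p) (x := x) fun j hj => h2 j (by omega)
    apply hp
    exact (Nat.modEq_iff_dvd' (by omega : i ≤ i + p)).1 (e1.trans e2.symm) |>.trans (by simp)

end IsArshonSigns

/-! ### Periods congruent to `±1` modulo `n` -/

theorem even_of_neg_one_pow_add {m M : ℕ} (h : (-1 : ℤ) ^ (m + M) = (-1) ^ m) : Even M := by
  rw [pow_add] at h
  by_contra hM
  rw [(Nat.not_even_iff_odd.1 hM).neg_one_pow] at h
  have := neg_one_pow_eq_or_int m
  omega

namespace IsArshonSigns

variable {n : ℕ} {w : ℕ → ZMod n} {s : ℕ → ℤ}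

theorem intCast_eq_zero_of_word_eq (h : IsArshonSigns n w s) {a : ℕ} (t : ℕ)
    (hw : w a = w (a + t)) : ((∑ j ∈ Finset.range t, s (a + j) : ℤ) : ZMod n) = 0 := by
  have key : w (a + t) = w a + ((∑ j ∈ Finset.range t, s (a + j) : ℤ) : ZMod n) := by
    clear hw
    induction t with
    | zero => simp
    | succ t ih =>
      rw [← add_assoc, h.step, ih, Finset.sum_range_succ]
      push_cast
      ring
  rwa [← hw, left_eq_add] at key

theorem word_ne_add_one (h : IsArshonSigns n w s) (hn : 3 ≤ n) (a : ℕ) : w a ≠ w (a + 1) := by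
  intro e
  have e1 := h.intCast_eq_zero_of_word_eq 1 e
  have := h.sign a
  refine ZMod.intCast_ne_zero_of_lt ?_ ?_ e1 <;> simp <;> rcases this with e | e <;> simp [e]
  all_goals omega

/-- The sum is `±1` or `±3`. -/
theorem order_eq_three_of_sum_three_signs (h : IsArshonSigns n w s) (hn : 3 ≤ n) {a : ℕ}
    (hs : ((s a + s (a + 1) + s (a + 2) : ℤ) : ZMod n) = 0) : n = 3 := by
  by_contra hne
  have h0 := h.sign a
  have h1 := h.sign (a + 1)
  have h2 := h.sign (a + 2)
  refine ZMod.intCast_ne_zero_of_lt ?_ ?_ hs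
  · omega
  · rw [abs_lt]
    omega

/-- The `M + 1` signs sum to `0` mod `n`, and the first cancels the last. For `M = 2` a single sign
is left, for `M = 4` three. -/
theorem order_eq_three_of_word_eq (h : IsArshonSigns n w s) (hn : 3 ≤ n) {a M : ℕ} (hM : Even M)
    (hM6 : M < 6) (h0 : M ≠ 0) (hs : s (a + M) = - s a) (hw : w a = w (a + (M + 1))) :
    n = 3 ∧ M = 4 := by
  have e := h.intCast_eq_zero_of_word_eq _ hw
  obtain ⟨r, rfl⟩ := hM
  rcases (show r = 1 ∨ r = 2 by omega) with rfl | rfl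
  · simp only [Finset.sum_range_succ, Finset.sum_range_zero] at e
    simp only [Nat.reduceAdd, add_zero, zero_add] at e hs
    rw [hs] at e
    have := h.sign (a + 1)
    refine absurd e (ZMod.intCast_ne_zero_of_lt ?_ ?_)
    · omega
    · rw [abs_lt]
      omega
  · simp only [Finset.sum_range_succ, Finset.sum_range_zero] at e
    simp only [Nat.reduceAdd, add_zero, zero_add] at e hs
    rw [hs] at e
    refine ⟨h.order_eq_three_of_sum_three_signs hn (a := a + 1) ?_, rfl⟩
    rw [← e]
    congr 1
    simp only [add_assoc, Nat.reduceAdd]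
    ring

theorem false_of_mul_add_one (h : IsArshonSigns n w s) (hn : 3 ≤ n) {i M q c : ℕ}
    (hw : ∀ j, i ≤ j → j < i + q → w j = w (j + (n * M + 1)))
    (hs : ∀ j, i ≤ j → j + 1 < i + q → s j = s (j + (n * M + 1)))
    (hic : i ≤ c) (hcq : c + 2 < i + q) (hc : s c ≠ s (c + 1))
    (hbad : n * (n * M + 1) + 2 * q < 2 * n * q) : False := by
  obtain ⟨m, ⟨h1, h2⟩ | ⟨h1, h2⟩⟩ := h.of_ne hn hc
  swap
  · rw [hs c hic (by omega), hs (c + 1) (by omega) (by omega),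
      show c + (n * M + 1) = n * (m + M + 1) + 0 by rw [mul_add, mul_add]; omega,
      show c + 1 + (n * M + 1) = n * (m + M + 1) + 1 by rw [mul_add, mul_add]; omega,
      h.inner _ _ (by omega), h.inner _ _ (by omega)] at hc
    exact hc rfl
  have e1 := hs c hic (by omega)
  have e2 := hs (c + 1) (by omega) (by omega)
  rw [show c + (n * M + 1) = n * (m + M) + (n - 1) by rw [mul_add]; omega,
    show c = n * m + (n - 2) by omega, h.inner _ _ (by omega), h.last _ _ (by omega)] at e1
  rw [show c + 1 + (n * M + 1) = n * (m + M + 1) + 0 by rw [mul_add, mul_add]; omega,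
    show c + 1 = n * m + (n - 1) by omega, h.inner (m + M + 1) 0 (by omega),
    h.last m _ (by omega)] at e2
  have hM : Even M := even_of_neg_one_pow_add (m := m) (by rw [pow_succ] at e2; omega)
  have hsM (a : ℕ) : (-1 : ℤ) ^ (a + M) = (-1) ^ a := by rw [pow_add, hM.neg_one_pow, mul_one]
  -- The shift carries the boundary sign of a block to an inner sign (`F1`), and the last inner sign
  -- to a boundary sign (`F2`).
  have F1 (a : ℕ) (ha : i < n * a + n) (hb : n * a + n < i + q) : s a = -(-1) ^ a := by
    have := hs (n * a + (n - 1)) (by omega) (by omega)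
    rw [show n * a + (n - 1) + (n * M + 1) = n * (a + 1 + M) + 0 by rw [mul_add, mul_add]; omega,
      h.inner (a + 1 + M) 0 (by omega), h.last a _ (by omega), hsM, pow_succ] at this
    omega
  have F2 (a : ℕ) (ha : i + 1 < n * a + n) (hb : n * a + n < i + q + 1) :
      s (a + M) = (-1) ^ a := by
    have := hs (n * a + (n - 2)) (by omega) (by omega)
    rw [show n * a + (n - 2) + (n * M + 1) = n * (a + M) + (n - 1) by rw [mul_add]; omega,
      h.inner _ _ (by omega), h.last _ _ (by omega)] at this
    exact this.symm
  -- A longer window has at least `3n - 1` signs. It contains three consecutive block ends, unless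
  -- it starts at a block start; then it contains the three positions just before block ends.
  have hq : q + 1 ≤ 3 * n := by
    by_contra hlt
    have hr := Nat.mod_lt i (show 0 < n by omega)
    have hd := Nat.div_add_mod i n
    set a := i / n
    rcases Nat.eq_zero_or_pos (i % n) with h0 | h0
    · have g0 := F2 a (by omega) (by omega)
      have g1 := F2 (a + 1) (by rw [mul_add]; omega) (by rw [mul_add]; omega)
      have g2 := F2 (a + 2) (by rw [mul_add]; omega) (by rw [mul_add]; omega)
      rw [pow_succ] at g1
      rw [pow_add] at g2
      refine h.not_alternating hn (c := a + M) ?_ ?_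
      · rw [show a + M + 1 = a + 1 + M by ring, g0, g1]
        ring
      · rw [show a + M + 2 = a + 2 + M by ring, g0, g2]
        ring
    · have g0 := F1 a (by omega) (by omega)
      have g1 := F1 (a + 1) (by rw [mul_add]; omega) (by rw [mul_add]; omega)
      have g2 := F1 (a + 2) (by rw [mul_add]; omega) (by rw [mul_add]; omega)
      rw [pow_succ] at g1
      rw [pow_add] at g2
      refine h.not_alternating hn (c := a) ?_ ?_
      · rw [g0, g1]
        ring
      · rw [g0, g2]
        ring
  obtain ⟨d, rfl⟩ : ∃ d, n = d + 3 := ⟨n - 3, by omega⟩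
  obtain ⟨e, he⟩ : ∃ e, 3 * (d + 3) = q + 1 + e := ⟨3 * (d + 3) - (q + 1), by omega⟩
  have hp : (d + 3) * M + 8 < 6 * (d + 3) := by nlinarith
  have hM6 : M < 6 := by nlinarith
  have hM0 : M ≠ 0 := by
    rintro rfl
    exact h.word_ne_add_one hn i (by simpa using hw i le_rfl (by omega))
  have e3 := hw (c + 1) (by omega) (by omega)
  rw [show c + 1 + ((d + 3) * M + 1) = (d + 3) * (m + M + 1) + 0 by rw [mul_add, mul_add]; omega,
    show c + 1 = (d + 3) * m + (d + 2) by omega, h.word _ _ (by omega), h.word _ _ (by omega),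
    ZMod.natCast_eq_neg_one (n := d + 3) (k := d + 2) (by omega)] at e3
  -- The last letter of block `m` equals the first letter of block `m + M + 1`; their orientations
  -- are opposite, so the parent letters agree.
  have e4 : w m = w (m + (M + 1)) := by
    rw [← add_assoc]
    rcases Nat.even_or_odd m with hm | hm
    · simp only [hm, if_true, hm.add hM, Nat.even_add_one, not_true, if_false] at e3
      push_cast at e3
      linear_combination e3
    · simp only [Nat.not_even_iff_odd.2 hm, if_false, hM, Nat.even_add_one, Nat.even_add,
        iff_true, not_false_iff, if_true] at e3
      push_cast at e3
      linear_combination e3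
  have := h.order_eq_three_of_word_eq hn hM hM6 hM0 (by rw [← e1, h2]; ring) e4
  obtain ⟨h3, rfl⟩ := this
  omega

theorem false_of_mul_sub_one (h : IsArshonSigns n w s) (hn : 3 ≤ n) {i p M q c : ℕ}
    (hpM : p + 1 = n * M) (hw : ∀ j, i ≤ j → j < i + q → w j = w (j + p))
    (hs : ∀ j, i ≤ j → j + 1 < i + q → s j = s (j + p))
    (hic : i ≤ c) (hcq : c + 2 < i + q) (hc : s c ≠ s (c + 1))
    (hbad : n * p + 2 * q < 2 * n * q) : False := by
  have hM0 : M ≠ 0 := by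
    rintro rfl
    simp at hpM
  obtain ⟨m, ⟨h1, h2⟩ | ⟨h1, h2⟩⟩ := h.of_ne hn hc
  · rw [hs c hic (by omega), hs (c + 1) (by omega) (by omega),
      show c + p = n * (m + M) + (n - 3) by rw [mul_add]; omega,
      show c + 1 + p = n * (m + M) + (n - 2) by rw [mul_add]; omega,
      h.inner _ _ (by omega), h.inner _ _ (by omega)] at hc
    exact absurd rfl hc
  have e1 := hs c hic (by omega)
  have e2 := hs (c + 1) (by omega) (by omega)
  rw [show c + p = n * (m + M) + (n - 2) by rw [mul_add]; omega,
    show c = n * m + (n - 1) by omega, h.inner (m + M) _ (by omega),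
    h.last m _ (by omega)] at e1
  rw [show c + 1 + p = n * (m + M) + (n - 1) by rw [mul_add]; omega,
    show c + 1 = n * (m + 1) + 0 by rw [mul_add]; omega, h.inner _ _ (by omega),
    h.last _ _ (by omega)] at e2
  have hM : Even M := even_of_neg_one_pow_add (m := m) (by omega)
  have hsM (a : ℕ) : (-1 : ℤ) ^ (a + M) = (-1) ^ a := by rw [pow_add, hM.neg_one_pow, mul_one]
  have F1 (a : ℕ) (ha : i < n * a + n) (hb : n * a + n < i + q) : s a = (-1) ^ a := by
    have := hs (n * a + (n - 1)) (by omega) (by omega)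
    rw [show n * a + (n - 1) + p = n * (a + M) + (n - 2) by rw [mul_add]; omega,
      h.inner (a + M) _ (by omega), h.last a _ (by omega), hsM] at this
    omega
  have F2 (a : ℕ) (ha : i ≤ n * a + n) (hb : n * a + n + 1 < i + q) :
      s (a + M) = -(-1) ^ a := by
    have := hs (n * (a + 1) + 0) (by rw [mul_add]; omega) (by rw [mul_add]; omega)
    rw [show n * (a + 1) + 0 + p = n * (a + M) + (n - 1) by rw [mul_add, mul_add]; omega,
      h.inner _ _ (by omega), h.last _ _ (by omega), pow_succ] at this
    omega
  have hq : q + 1 ≤ 3 * n := by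
    by_contra hlt
    have hr := Nat.mod_lt i (show 0 < n by omega)
    have hd := Nat.div_add_mod i n
    set a := i / n
    rcases Nat.eq_zero_or_pos (i % n) with h0 | h0
    -- The window starts at a block start, which `F2` does not cover; this is the first of three
    -- signs taken at block starts.
    · have f0 := hs (n * a + 0) (by omega) (by omega)
      rw [show n * a + 0 + p = n * (a + (M - 1)) + (n - 1) by
          have := Nat.le_mul_of_pos_right n (Nat.pos_of_ne_zero hM0)
          rw [mul_add, Nat.mul_sub]
          omega,
        h.inner _ _ (by omega), h.last _ _ (by omega)] at f0
      have g1 := F2 a (by omega) (by omega)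
      have g2 := F2 (a + 1) (by rw [mul_add]; omega) (by rw [mul_add]; omega)
      rw [pow_succ] at g2
      refine h.not_alternating hn (c := a + (M - 1)) ?_ ?_
      · rw [show a + (M - 1) + 1 = a + M by omega, ← f0, g1]
      · rw [show a + (M - 1) + 2 = a + 1 + M by omega, ← f0, g2]
        ring
    · have g0 := F1 a (by omega) (by omega)
      have g1 := F1 (a + 1) (by rw [mul_add]; omega) (by rw [mul_add]; omega)
      have g2 := F1 (a + 2) (by rw [mul_add]; omega) (by rw [mul_add]; omega)
      rw [pow_succ] at g1
      rw [pow_add] at g2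
      refine h.not_alternating hn (c := a) ?_ ?_
      · rw [g0, g1]
        ring
      · rw [g0, g2]
        ring
  obtain ⟨d, rfl⟩ : ∃ d, n = d + 3 := ⟨n - 3, by omega⟩
  obtain ⟨e, he⟩ : ∃ e, 3 * (d + 3) = q + 1 + e := ⟨3 * (d + 3) - (q + 1), by omega⟩
  have hp : p + 7 < 6 * (d + 3) := by nlinarith
  have hM6 : M < 6 := by nlinarith
  have e3 := hw (c + 1) (by omega) (by omega)
  rw [show c + 1 + p = (d + 3) * (m + M) + (d + 2) by rw [mul_add]; omega,
    show c + 1 = (d + 3) * (m + 1) + 0 by rw [mul_add]; omega, h.word _ _ (by omega),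
    h.word _ _ (by omega),
    ZMod.natCast_eq_neg_one (n := d + 3) (k := d + 2) (by omega)] at e3
  have e4 : w (m + 1) = w (m + M) := by
    rcases Nat.even_or_odd m with hm | hm
    · simp only [hm, if_true, hm.add hM, Nat.even_add_one, not_true, if_false] at e3
      push_cast at e3
      linear_combination e3
    · simp only [Nat.not_even_iff_odd.2 hm, if_false, hM, Nat.even_add_one, Nat.even_add,
        iff_true, not_false_iff, if_true] at e3
      push_cast at e3
      linear_combination e3
  obtain ⟨r, rfl⟩ := hM
  rcases (show r = 1 ∨ r = 2 by omega) with rfl | rfl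
  · exact h.word_ne_add_one hn _ e4
  · have e5 := h.intCast_eq_zero_of_word_eq (a := m + 1) 3 e4
    simp only [Finset.sum_range_succ, Finset.sum_range_zero] at e5
    have := h.order_eq_three_of_sum_three_signs hn (a := m + 1) (by simpa using e5)
    omega

/-! ### Divisibility of the period and descent -/

theorem sign_eq_of_word_eq (h : IsArshonSigns n w s) (hn : 3 ≤ n) {a b : ℕ} (h1 : w a = w b)
    (h2 : w (a + 1) = w (b + 1)) : s a = s b := by
  rw [h.step, h.step, h1, add_right_inj] at h2
  by_contra hne
  refine ZMod.intCast_ne_zero_of_lt (n := n) (sub_ne_zero.2 hne) ?_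
    (by push_cast; rw [h2, sub_self])
  have := h.sign a
  have := h.sign b
  rw [abs_lt]
  omega

theorem dvd_of_repetition (h : IsArshonSigns n w s) (hn : 3 ≤ n) {i p q : ℕ} (hp : 0 < p)
    (hw : ∀ j, i ≤ j → j < i + q → w j = w (j + p)) (hbad : n * p + 2 * q < 2 * n * q) :
    n ∣ p := by
  by_contra hdvd
  have hs : ∀ j, i ≤ j → j + 1 < i + q → s j = s (j + p) := fun j h1 h2 =>
    h.sign_eq_of_word_eq hn (hw j h1 (by omega))
      (by rw [hw (j + 1) (by omega) h2, show j + 1 + p = j + p + 1 by ring])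
  have hq0 : 0 < q := by
    by_contra hq
    obtain rfl : q = 0 := by omega
    simp at hbad
  have hp1 : p ≠ 1 := by
    rintro rfl
    exact h.word_ne_add_one hn i (hw i le_rfl (by omega))
  have hq2 : 2 ≤ q := by
    by_contra hq
    obtain rfl : q = 1 := by omega
    nlinarith [show 2 ≤ p by omega]
  by_cases hch : ∃ c, i ≤ c ∧ c + 2 < i + q ∧ s c ≠ s (c + 1)
  · obtain ⟨c, hic, hcq, hc⟩ := hch
    have hd := Nat.div_add_mod p n
    have hr := Nat.mod_lt p (show 0 < n by omega)
    have hr0 : p % n ≠ 0 := fun e => hdvd (Nat.dvd_of_mod_eq_zero e)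
    rcases (show p % n = 1 ∨ p % n + 1 = n ∨ 2 ≤ p % n ∧ p % n + 2 ≤ n by omega) with h1 | h1 | h1
    · obtain ⟨M, rfl⟩ : ∃ M, p = n * M + 1 := ⟨p / n, by omega⟩
      exact h.false_of_mul_add_one hn hw hs hic hcq hc hbad
    · exact h.false_of_mul_sub_one hn (M := p / n + 1) (by rw [mul_add]; omega) hw hs hic hcq hc
        hbad
    -- For the remaining residues the shift carries both signs into the interior of one block, where
    -- they agree.
    · apply hc
      rw [hs c hic (by omega), hs (c + 1) (by omega) hcq]
      obtain ⟨m, ⟨h2, -⟩ | ⟨h2, -⟩⟩ := h.of_ne hn hc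
      · rw [show c + p = n * (m + p / n + 1) + (p % n - 2) by rw [mul_add, mul_add]; omega,
          show c + 1 + p = n * (m + p / n + 1) + (p % n - 1) by rw [mul_add, mul_add]; omega,
          h.inner _ _ (by omega), h.inner _ _ (by omega)]
      · rw [show c + p = n * (m + p / n + 1) + (p % n - 1) by rw [mul_add, mul_add]; omega,
          show c + 1 + p = n * (m + p / n + 1) + (p % n) by rw [mul_add, mul_add]; omega,
          h.inner _ _ (by omega), h.inner _ _ (by omega)]
  · push Not at hch
    have hconst : ∀ j < q - 1, s (i + j) = s i := by
      intro j hj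
      induction j with
      | zero => rfl
      | succ j ih => rw [← ih (by omega), ← add_assoc, hch (i + j) (by omega) (by omega)]
    refine h.false_of_constant hn (i := i) (p := p) (L := q - 1) (by omega) hdvd
      (hw i le_rfl (by omega)) hconst (fun j hj => ?_) ?_
    · rw [show i + p + j = i + j + p by ring, ← hs (i + j) (by omega) (by omega), hconst j hj]
    · rwa [show q - 1 + 1 = q by omega]

/-- Repetitions in an Arshon word are short with respect to their period. -/
theorem repetition_le (h : IsArshonSigns n w s) (hn : 3 ≤ n) {p : ℕ} (hp : 0 < p) :
    ∀ i q : ℕ, (∀ j, i ≤ j → j < i + q → w j = w (j + p)) → 2 * n * q ≤ n * p + 2 * q := by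
  induction p using Nat.strong_induction_on with
  | _ p ih =>
    intro i q hw
    by_contra hbad
    rw [not_le] at hbad
    obtain ⟨p, rfl⟩ := h.dvd_of_repetition hn hp hw hbad
    have hp0 : 0 < p := Nat.pos_of_mul_pos_left hp
    have hq2 : 3 ≤ q := by
      by_contra hq
      have : q ≤ 2 := by omega
      nlinarith
    have hdm (j : ℕ) : n * (j / n) + j % n = j := Nat.div_add_mod j n
    have hml (j : ℕ) : j % n < n := Nat.mod_lt j (by omega)
    have hev : Even p := by
      -- One of two adjacent positions is inner; its sign shows the parity of its block.
      obtain ⟨j, hj1, hj2, hj⟩ : ∃ j, i ≤ j ∧ j ≤ i + 1 ∧ j % n + 1 < n := by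
        by_contra! hcon
        have e1 := hcon i le_rfl (by omega)
        have e2 := hcon (i + 1) (by omega) le_rfl
        have e3 : i % n = (i + 1) % n := by have := hml i; have := hml (i + 1); omega
        have : n ∣ 1 := by simpa using (Nat.modEq_iff_dvd' (by omega : i ≤ i + 1)).1 e3
        have := Nat.le_of_dvd one_pos this
        omega
      have e := h.sign_eq_of_word_eq hn (hw j hj1 (by omega))
        (by rw [hw (j + 1) (by omega) (by omega), show j + 1 + n * p = j + n * p + 1 by ring])
      have e1 := h.inner (j / n) _ hj
      have e2 := h.inner (j / n + p) _ hj
      rw [hdm] at e1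
      rw [mul_add, add_right_comm, hdm] at e2
      exact even_of_neg_one_pow_add (e2.symm.trans (e.symm.trans e1))
    have hlt : p < n * p := by nlinarith
    -- Every block that meets the window counts, since one letter determines the parent. There are
    -- at least `q / n` of them, so the ratio of overlap to period does not drop.
    have hdesc := ih p hlt hp0 (i / n) ((i + q - 1) / n - i / n + 1) (fun m h1 h2 => by
      have h3 : i / n ≤ (i + q - 1) / n := Nat.div_le_div_right (by omega)
      have h4 : m ≤ (i + q - 1) / n := by omega
      have h5 : n * m ≤ n * ((i + q - 1) / n) := Nat.mul_le_mul_left n h4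
      have h6 : n * (i / n) ≤ n * m := Nat.mul_le_mul_left n h1
      have h7 := hdm i
      have h8 := hdm (i + q - 1)
      have h9 := hml i
      obtain ⟨k, hk, hk1, hk2⟩ : ∃ k < n, i ≤ n * m + k ∧ n * m + k < i + q := by
        rcases le_total i (n * m) with hi | hi
        · exact ⟨0, by omega, by omega, by omega⟩
        · exact ⟨i - n * m, by omega, by omega, by omega⟩
      have e := hw _ hk1 hk2
      rw [show n * m + k + n * p = n * (m + p) + k by ring, h.word _ _ hk, h.word _ _ hk] at e
      by_cases hm : Even m
      · simpa [Nat.even_add, hev, hm] using e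
      · simpa [Nat.even_add, hev, hm] using e)
    have h3 : i / n ≤ (i + q - 1) / n := Nat.div_le_div_right (by omega)
    obtain ⟨t, ht⟩ := Nat.exists_eq_add_of_le h3
    rw [ht, Nat.add_sub_cancel_left] at hdesc
    have h7 := hdm i
    have h8 := hdm (i + q - 1)
    have h9 := hml (i + q - 1)
    rw [ht, mul_add] at h8
    have hqt : q ≤ n * (t + 1) := by
      rw [mul_add]
      omega
    obtain ⟨d, rfl⟩ : ∃ d, n = d + 3 := ⟨n - 3, by omega⟩
    nlinarith

end IsArshonSigns

/-! ### The case `n = 2` -/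

theorem thueMorse_two_mul (m : ℕ) : thueMorse (2 * m) = thueMorse m := by
  rcases Nat.eq_zero_or_pos m with rfl | hm
  · rfl
  · simp [thueMorse, Nat.digits_def' (b := 2) (n := 2 * m) (by norm_num) (by omega)]

theorem thueMorse_two_mul_add_one (m : ℕ) :
    thueMorse (2 * m + 1) = 1 - thueMorse m := by
  have : (2 * m + 1) / 2 = m := by omega
  rw [thueMorse, thueMorse, Nat.digits_def' (b := 2) (n := 2 * m + 1) (by norm_num) (by omega),
    this, List.sum_cons]
  omega

theorem thueMorse_lt_two (m : ℕ) : thueMorse m < 2 := Nat.mod_lt _ (by norm_num)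

/-- The Thue–Morse word is overlap-free. -/
theorem thueMorse_repetition_le {p : ℕ} (hp : 0 < p) :
    ∀ i q : ℕ, (∀ j, i ≤ j → j < i + q → thueMorse j = thueMorse (j + p)) → q ≤ p := by
  have hne (m : ℕ) (hm : Even m) : thueMorse (m + 1) = 1 - thueMorse m := by
    obtain ⟨r, rfl⟩ := hm
    rw [← two_mul, thueMorse_two_mul, thueMorse_two_mul_add_one]
  induction p using Nat.strong_induction_on with
  | _ p ih =>
    intro i q hw
    by_contra hq
    rcases Nat.even_or_odd p with ⟨r, rfl⟩ | hodd
    · have := ih r (by omega) (by omega) (i / 2) (r + 1) (fun m h1 h2 => by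
        rcases le_total i (2 * m) with hi | hi
        · have e := hw (2 * m) hi (by omega)
          rwa [show 2 * m + (r + r) = 2 * (m + r) by ring, thueMorse_two_mul,
            thueMorse_two_mul] at e
        · have e := hw (2 * m + 1) (by omega) (by omega)
          rw [show 2 * m + 1 + (r + r) = 2 * (m + r) + 1 by ring, thueMorse_two_mul_add_one,
            thueMorse_two_mul_add_one] at e
          have := thueMorse_lt_two m
          have := thueMorse_lt_two (m + r)
          omega)
      omega
    -- For odd `p`, either `i + j` or its shift is even and so starts a block `01` or `10`. The
    -- window alternates, against equality at the odd distance `p`.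
    · have halt (j : ℕ) (hj : j < p) : thueMorse (i + j + 1) = 1 - thueMorse (i + j) := by
        rcases Nat.even_or_odd (i + j) with he | ho
        · exact hne _ he
        · rw [hw (i + j + 1) (by omega) (by omega), hw (i + j) (by omega) (by omega),
            ← hne _ (ho.add_odd hodd)]
          congr 1
          ring
      have hpar (j : ℕ) : j ≤ p → thueMorse (i + j) = if Even j then thueMorse i
          else 1 - thueMorse i := by
        induction j with
        | zero => simp
        | succ j ihj =>
          intro hj
          rw [← add_assoc, halt j (by omega), ihj (by omega)]
          have := thueMorse_lt_two i
          by_cases he : Even j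
          · simp [he, Nat.even_add_one]
          · simp [he, Nat.even_add_one]
            omega
      have e := hw i le_rfl (by omega)
      rw [hpar p le_rfl, if_neg (Nat.not_even_iff_odd.2 hodd)] at e
      have := thueMorse_lt_two i
      omega

theorem arshonWord_repetition_le {n : ℕ} (hn : 2 ≤ n) {p : ℕ} (hp : 0 < p) (i q : ℕ)
    (hw : ∀ j, i ≤ j → j < i + q → arshonWord n j = arshonWord n (j + p)) :
    2 * n * q ≤ n * p + 2 * q := by
  rcases hn.eq_or_lt with rfl | hn3
  · have := thueMorse_repetition_le hp i q (fun j h1 h2 => by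
      have e := hw j h1 h2
      simp only [arshonWord, if_true] at e
      rw [ZMod.natCast_eq_natCast_iff] at e
      exact Nat.ModEq.eq_of_lt_of_lt e (thueMorse_lt_two _) (thueMorse_lt_two _))
    omega
  · obtain ⟨s, hs⟩ := exists_isArshonSigns hn3
    refine hs.repetition_le hn3 hp i q fun j h1 h2 => ?_
    simpa [arshonWord, show n ≠ 2 by omega] using hw j h1 h2

/-! ### Fractional powers as repetitions -/

theorem List.getElem?_add_length_of_power {α : Type*} {x y : List α} (hy : y <+: x) (m : ℕ)
    {j : ℕ} (hj : j + x.length < ((List.replicate m x).flatten ++ y).length) :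
    ((List.replicate m x).flatten ++ y)[j]? =
      ((List.replicate m x).flatten ++ y)[j + x.length]? := by
  -- Being a prefix of its own translate by `x` is exactly having period `|x|`.
  have h1 : (List.replicate m x).flatten ++ y <+: x ++ ((List.replicate m x).flatten ++ y) := by
    rw [← List.append_assoc, ← List.flatten_cons, ← List.replicate_succ, List.replicate_succ',
      List.flatten_append, List.append_assoc]
    exact (List.prefix_append_right_inj _).2 (hy.trans (by simp))
  generalize (List.replicate m x).flatten ++ y = z at h1 hj ⊢
  rw [List.getElem?_eq_getElem hj, List.getElem?_eq_getElem (by omega), h1.getElem hj,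
    List.getElem_append_right (by omega)]
  simp

theorem exists_repetition_of_isFracPower {α : Type*} {w : ℕ → α} {i l : ℕ} {r : ℚ}
    (h : IsFracPower (subwordAt w i l) r) :
    ∃ p q : ℕ, 0 < p ∧ r = ((p + q : ℕ) : ℚ) / p ∧ ∀ j, i ≤ j → j < i + q → w j = w (j + p) := by
  obtain ⟨x, y, m, hx, hm, hy, hz, rfl⟩ := h
  have hl : (subwordAt w i l).length = l := by simp [subwordAt]
  have hxl : x.length ≤ l := by
    rw [← hl, hz]
    obtain ⟨m, rfl⟩ : ∃ k, m = k + 1 := ⟨m - 1, by omega⟩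
    simp [List.replicate_succ]
  refine ⟨x.length, l - x.length, List.length_pos_iff.2 hx, ?_, fun j h1 h2 => ?_⟩
  · rw [hl, Nat.add_sub_cancel' hxl]
  · have e := List.getElem?_add_length_of_power hy m (j := j - i) (by rw [← hz, hl]; omega)
    rw [← hz] at e
    simp only [subwordAt, List.getElem?_map] at e
    rw [List.getElem?_range (by omega), List.getElem?_range (by omega)] at e
    simp only [Option.map_some, Option.some.injEq] at e
    rwa [show i + (j - i) = j by omega, show i + (j - i + x.length) = j + x.length by omega] at e

theorem isFracPower_of_repetition {α : Type*} {w : ℕ → α} {i p q : ℕ} (hp : 0 < p) (hq : q ≤ p)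
    (hw : ∀ j < q, w (i + j) = w (i + p + j)) :
    IsFracPower (subwordAt w i (p + q)) (((p + q : ℕ) : ℚ) / p) := by
  refine ⟨subwordAt w i p, subwordAt w i q, 1, ?_, le_rfl, ?_, ?_, ?_⟩
  · apply List.ne_nil_of_length_pos
    simpa [subwordAt] using hp
  · obtain ⟨d, rfl⟩ := Nat.exists_eq_add_of_le hq
    simp [subwordAt, List.range_add]
  · simp only [subwordAt, List.range_add, List.map_append, List.map_map, List.replicate_one,
      List.flatten_singleton, List.append_cancel_left_eq]
    refine List.map_congr_left fun j hj => ?_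
    simp only [Function.comp, ← add_assoc]
    exact (hw j (List.mem_range.1 hj)).symm
  · simp [subwordAt]

/-! ### Attainment and conclusion -/

theorem exists_isFracPower_arshonWord {n : ℕ} (hn : 2 ≤ n) :
    ∃ l : ℕ, IsFracPower (subwordAt (arshonWord n) 1 l)
      ((3 * (n : ℚ) - 2) / (2 * (n : ℚ) - 2)) := by
  rcases hn.eq_or_lt with rfl | hn3
  · refine ⟨1 + 1, ?_⟩
    convert isFracPower_of_repetition (w := arshonWord 2) (i := 1) (p := 1) (q := 1) one_pos le_rfl
      (fun j hj => ?_) using 1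
    · norm_num
    · obtain rfl : j = 0 := by omega
      simp [arshonWord, thueMorse]
  · have hl (k : ℕ) (hk : k < n) : arshonLimit n k = k := arshonLimit_of_lt hn hk
    have hw (k : ℕ) : arshonWord n k = arshonLimit n k := by
      simp [arshonWord, show n ≠ 2 by omega]
    -- The word `1 2 ⋯ (n-1) 0` at position `1` recurs at `2n - 1`: the last letter of block `1` is
    -- `1`, and block `2` begins `2 3 ⋯ (n-1) 0`.
    refine ⟨2 * n - 2 + n, ?_⟩
    convert isFracPower_of_repetition (w := arshonWord n) (i := 1) (p := 2 * n - 2) (q := n)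
      (by omega) (by omega) (fun j hj => ?_) using 1
    · push_cast [Nat.cast_sub (show 2 ≤ 2 * n by omega)]
      ring
    · have e1 : arshonLimit n (1 + j) = ((1 + j : ℕ) : ZMod n) := by
        rcases (show 1 + j < n ∨ 1 + j = n by omega) with h | h
        · exact hl _ h
        · have := arshonLimit_mul_add hn 1 0 (by omega)
          rw [h]
          simpa [hl 1 (by omega)] using this
      have e2 : arshonLimit n (1 + (2 * n - 2) + j) = ((1 + j : ℕ) : ZMod n) := by
        rcases Nat.eq_zero_or_pos j with rfl | h
        · rw [show 1 + (2 * n - 2) + 0 = n * 1 + (n - 1) by omega,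
            arshonLimit_mul_add hn 1 _ (by omega), hl 1 (by omega),
            ZMod.natCast_eq_neg_one (n := n) (k := n - 1) (by omega)]
          simp
        · rw [show 1 + (2 * n - 2) + j = n * 2 + (j - 1) by omega,
            arshonLimit_mul_add hn 2 _ (by omega), hl 2 (by omega)]
          simp only [even_two, if_true]
          rw [← Nat.cast_add]
          congr 1
          omega
      rw [hw, hw, e1, e2]

theorem theorem1 (n : ℕ) (hn : 2 ≤ n) :
    criticalExponent (arshonWord n) =
        (((3 * (n : ℝ) - 2) / (2 * (n : ℝ) - 2) : ℝ) : EReal) ∧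
      ∃ l : ℕ, IsFracPower (subwordAt (arshonWord n) 1 l)
        ((3 * (n : ℚ) - 2) / (2 * (n : ℚ) - 2)) := by
  have hex := exists_isFracPower_arshonWord hn
  have hn2 : (2 : ℚ) ≤ n := by exact_mod_cast hn
  refine ⟨IsGreatest.csSup_eq ⟨?_, ?_⟩, hex⟩
  · obtain ⟨l, hl⟩ := hex
    refine ⟨_, ?_, ⟨1, l, hl⟩, ?_⟩
    · rw [le_div_iff₀ (by linarith)]
      linarith
    · push_cast
      rfl
  · rintro _ ⟨r, -, ⟨i, l, hr⟩, rfl⟩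
    obtain ⟨p, q, hp, rfl, hw⟩ := exists_repetition_of_isFracPower hr
    have key : (2 * n * q : ℚ) ≤ n * p + 2 * q := by
      exact_mod_cast arshonWord_repetition_le hn hp i q hw
    have hp' : (0 : ℚ) < p := by exact_mod_cast hp
    have : (((p + q : ℕ) : ℚ) / p) ≤ (3 * (n : ℚ) - 2) / (2 * (n : ℚ) - 2) := by
      rw [div_le_div_iff₀ hp' (by linarith)]
      push_cast
      linarith
    rw [EReal.coe_le_coe_iff]
    have h2 : ((((p + q : ℕ) : ℚ) / p : ℚ) : ℝ) ≤
        (((3 * (n : ℚ) - 2) / (2 * (n : ℚ) - 2) : ℚ) : ℝ) := by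
      exact_mod_cast this
    refine h2.trans_eq ?_
    push_cast
    rfl
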